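/- Let $R_0>0$ and let $f,g$ be real functions on $(-R_0,R_0)$ that are even, vanish at $0$ and are positive on $(0,R_0)$. Put $F=-\ln f$ and $G=-\ln g$ on $(0,R_0)$, and assume that $F$ and $G$ tend to $+\infty$ at $0^+$ and are twice differentiable on $(0,R_0)$ with $F'<0$, $F''>0$, $G'<0$, $G''>0$. For a matrix function $A$ (with values in the symmetric nonnegative definite $n\times n$ matrices), a Lipschitz curve $\gamma:[0,r]\to\mathbb R^n$ is called subunit if for almost every $t\in[0,r]$ one has $(\xi\cdot\gamma'(t))^2\le \xi^{T}A(\gamma(t))\,\xi$ for all $\xi\in\mathbb R^n$; the Carnot–Carathéodory distance $d_A(p,q)$ is the infimum of all $r>0$ for which some subunit curve $\gamma:[0,r]\to\mathbb R^n$ joins $p$ to $q$ ($+\infty$ if there is none). Let $B(0,R)$ be the open ball of radius $R$ about the origin of $\mathbb R^3$ for $A(x)=\mathrm{diag}\{1,f^2(x_1),g^2(x_1)\}$, and let $B^{f}_{2D}(0,R)$ and $B^{g}_{2D}(0,R)$ be the open balls of radius $R$ about the origin of $\mathbb R^2$ for $\mathrm{diag}\{1,f^2(x_1)\}$ and $\mathrm{diag}\{1,g^2(x_1)\}$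 respectively. (For $0<R<R_0$ only curves with $|x_1|<R_0$ enter.) Then for every $0<R<R_0$ the projection of $B(0,R)$ onto the $xy$-plane is contained in $B^{f}_{2D}(0,R)$, the projection of $B(0,R)$ onto the $xz$-plane is contained in $B^{g}_{2D}(0,R)$, and $$|B(0,R)|\le C\,\min\left\{\frac{f(R)\,g(R)}{|F'(R)|^2\,|G'(R)|},\ \frac{f(R)\,g(R)}{|F'(R)|\,|G'(R)|^2}\right\},$$ where $|\cdot|$ of a set is Lebesgue measure and $C>0$ is an absolute constant, independent of $f$, $g$, $R_0$ and $R$. -/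

import Mathlib

open MeasureTheory Set Filter Topology
open scoped ENNReal NNReal Matrix

namespace CarnotCaratheodory

/-- `γ : [0, r] → ℝⁿ` is a subunit curve for the matrix function `A`: it is Lipschitz and
`(ξ · γ'(t))² ≤ ξᵀ A(γ(t)) ξ` for almost every `t ∈ [0, r]` and every `ξ ∈ ℝⁿ`.
(Being Lipschitz does not depend on the norm chosen on `ℝⁿ`.) -/
def IsSubunit {n : ℕ} (A : (Fin n → ℝ) → Matrix (Fin n) (Fin n) ℝ) (r : ℝ)
    (γ : ℝ → Fin n → ℝ) : Prop :=
  (∃ K : ℝ≥0, LipschitzOnWith K γ (Icc 0 r)) ∧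
    ∀ᵐ t ∂(volume.restrict (Icc 0 r)), DifferentiableAt ℝ γ t ∧
      ∀ ξ : Fin n → ℝ, (ξ ⬝ᵥ deriv γ t) ^ 2 ≤ ξ ⬝ᵥ (A (γ t) *ᵥ ξ)

/-- The Carnot–Carathéodory (subunit) distance of `A`: the infimum of all `r > 0` such that some
subunit curve `γ : [0, r] → ℝⁿ` joins `p` to `q` (and `∞` if there is none). -/
noncomputable def ccDist {n : ℕ} (A : (Fin n → ℝ) → Matrix (Fin n) (Fin n) ℝ)
    (p q : Fin n → ℝ) : ℝ≥0∞ :=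
  sInf {d : ℝ≥0∞ | ∃ r : ℝ, 0 < r ∧ d = ENNReal.ofReal r ∧
    ∃ γ : ℝ → Fin n → ℝ, IsSubunit A r γ ∧ γ 0 = p ∧ γ r = q}

/-- The open ball `B(p, R)` of the Carnot–Carathéodory distance of `A`. -/
def ccBall {n : ℕ} (A : (Fin n → ℝ) → Matrix (Fin n) (Fin n) ℝ)
    (p : Fin n → ℝ) (R : ℝ) : Set (Fin n → ℝ) :=
  {q | ccDist A p q < ENNReal.ofReal R}

/-- The matrix function `diag{1, f²(x₁)}` on `ℝ²`. -/
def diag2 (f : ℝ → ℝ) (p : Fin 2 → ℝ) : Matrix (Fin 2) (Fin 2) ℝ :=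
  Matrix.diagonal ![1, f (p 0) ^ 2]

/-- The matrix function `diag{1, f²(x₁), g²(x₁)}` on `ℝ³`. -/
def diag3 (f g : ℝ → ℝ) (p : Fin 3 → ℝ) : Matrix (Fin 3) (Fin 3) ℝ :=
  Matrix.diagonal ![1, f (p 0) ^ 2, g (p 0) ^ 2]

/-- The function `F = - ln f`, so that `f = e^{-F}` where `f > 0`. -/
noncomputable def negLog (f : ℝ → ℝ) (x : ℝ) : ℝ := -Real.log (f x)

/-- `f = e^{-F}` is a degenerate profile on `(-R₀, R₀)`: it is even, vanishes at `0` and is positive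
on `(0, R₀)`, where `F = - ln f` is twice differentiable with `F' < 0` and `F'' > 0`, and
`F(x) → +∞` as `x → 0⁺`. -/
structure IsDegenerateProfile (f : ℝ → ℝ) (R₀ : ℝ) : Prop where
  map_zero : f 0 = 0
  even : ∀ x ∈ Ioo 0 R₀, f (-x) = f x
  pos : ∀ x ∈ Ioo 0 R₀, 0 < f x
  tendsto : Tendsto (negLog f) (𝓝[>] 0) atTop
  differentiableAt : ∀ x ∈ Ioo 0 R₀, DifferentiableAt ℝ (negLog f) x
  differentiableAt_deriv : ∀ x ∈ Ioo 0 R₀, DifferentiableAt ℝ (deriv (negLog f)) x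
  deriv_neg : ∀ x ∈ Ioo 0 R₀, deriv (negLog f) x < 0
  deriv_deriv_pos : ∀ x ∈ Ioo 0 R₀, 0 < deriv (deriv (negLog f)) x

end CarnotCaratheodory

/-!
Let `γ` be a subunit curve of length `r < R` that starts at the origin. Its first coordinate is
`1`-Lipschitz, so `|γ₁(t)| ≤ τ - |t - τ|` with `τ = (|γ₁(r)| + r) / 2`. The tangent line of the
convex function `F` at `R` gives `f(x) ≤ f(R) exp(-a(R - |x|))` for `|x| < R`, where `a = |F'(R)|`.
The second coordinate has speed at most `f(γ₁)`; integrating the exponential `exp(-a|t - τ|)` bounds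
the second coordinate of the endpoint `q` by `(2 f(R) / a) exp(-a(R - |q₁|) / 2)`, and likewise the
third one with `g` and `b = |G'(R)|`. Integrating the product of these two widths over `|q₁| ≤ R`
gives a volume of at most `128 f(R) g(R) / (a b (a + b))`, which is below both terms of the minimum.
-/

namespace CarnotCaratheodory

theorem integral_exp_neg_mul_abs_sub {a : ℝ} (ha : 0 < a) (c : ℝ) :
    ∫ x, Real.exp (-(a * |x - c|)) = 2 / a := by
  rw [integral_sub_right_eq_self (fun x => Real.exp (-(a * |x|))) c,
    integral_comp_abs (f := fun x => Real.exp (-(a * x)))]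
  simp only [← neg_mul]
  rw [integral_exp_mul_Ioi (neg_neg_of_pos ha)]
  simp [div_eq_mul_inv]

theorem integrable_exp_neg_mul_abs_sub {a : ℝ} (ha : 0 < a) (c : ℝ) :
    Integrable fun x => Real.exp (-(a * |x - c|)) :=
  .of_integral_ne_zero (by rw [integral_exp_neg_mul_abs_sub ha]; positivity)

theorem intervalIntegral_exp_neg_mul_abs_sub_le {a s t : ℝ} (ha : 0 < a) (c : ℝ) (hst : s ≤ t) :
    ∫ x in s..t, Real.exp (-(a * |x - c|)) ≤ 2 / a := by
  rw [intervalIntegral.integral_of_le hst, ← integral_exp_neg_mul_abs_sub ha c]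
  exact setIntegral_le_integral (integrable_exp_neg_mul_abs_sub ha c)
    (ae_of_all _ fun _ => (Real.exp_pos _).le)

theorem lintegral_exp_neg_mul_sub_abs_sub_le {a : ℝ} (ha : 0 < a) (c R : ℝ) :
    ∫⁻ x in Icc (c - R) (c + R), ENNReal.ofReal (Real.exp (-(a * (R - |x - c|)))) ≤
      ENNReal.ofReal (4 / a) := by
  have hle (x : ℝ) (hx : x ∈ Icc (c - R) (c + R)) : Real.exp (-(a * (R - |x - c|))) ≤
      Real.exp (-(a * |x - (c - R)|)) + Real.exp (-(a * |x - (c + R)|)) := by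
    rw [abs_of_nonneg (sub_nonneg.2 hx.1), abs_of_nonpos (sub_nonpos.2 hx.2)]
    rcases abs_cases (x - c) with ⟨h, -⟩ | ⟨h, -⟩ <;> rw [h]
    · exact le_add_of_nonneg_of_le (Real.exp_pos _).le (le_of_eq (by ring_nf))
    · exact le_add_of_le_of_nonneg (le_of_eq (by ring_nf)) (Real.exp_pos _).le
  have hint := integrable_exp_neg_mul_abs_sub ha
  calc ∫⁻ x in Icc (c - R) (c + R), ENNReal.ofReal (Real.exp (-(a * (R - |x - c|))))
      ≤ ∫⁻ x in Icc (c - R) (c + R), ENNReal.ofReal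
          (Real.exp (-(a * |x - (c - R)|)) + Real.exp (-(a * |x - (c + R)|))) :=
        setLIntegral_mono (by fun_prop) fun x hx => ENNReal.ofReal_le_ofReal (hle x hx)
    _ ≤ ∫⁻ x, ENNReal.ofReal
          (Real.exp (-(a * |x - (c - R)|)) + Real.exp (-(a * |x - (c + R)|))) :=
        setLIntegral_le_lintegral _ _
    _ = ENNReal.ofReal
          (∫ x, (Real.exp (-(a * |x - (c - R)|)) + Real.exp (-(a * |x - (c + R)|)))) :=
        (ofReal_integral_eq_lintegral_ofReal ((hint _).add (hint _))
          (ae_of_all _ fun _ => add_nonneg (Real.exp_pos _).le (Real.exp_pos _).le)).symm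
    _ = ENNReal.ofReal (4 / a) := by
        rw [integral_add (hint _) (hint _), integral_exp_neg_mul_abs_sub ha,
          integral_exp_neg_mul_abs_sub ha]
        ring_nf

theorem volume_setOf_tail_mem_Icc {n : ℕ} {s : Set ℝ} {l u : ℝ → Fin n → ℝ} (hs : MeasurableSet s)
    (hl : Measurable l) (hu : Measurable u) :
    volume {p : Fin (n + 1) → ℝ | p 0 ∈ s ∧ Fin.tail p ∈ Icc (l (p 0)) (u (p 0))} =
      ∫⁻ x in s, ∏ i, ENNReal.ofReal (u x i - l x i) := by
  set T : Set (ℝ × (Fin n → ℝ)) := {q | q.1 ∈ s ∧ q.2 ∈ Icc (l q.1) (u q.1)}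
  have hT : MeasurableSet T := (measurable_fst hs).inter <|
    (measurableSet_le (hl.comp measurable_fst) measurable_snd).inter
      (measurableSet_le measurable_snd (hu.comp measurable_fst))
  have hslice (x : ℝ) : volume (Prod.mk x ⁻¹' T) =
      s.indicator (fun x => ∏ i, ENNReal.ofReal (u x i - l x i)) x := by
    by_cases hx : x ∈ s
    · rw [indicator_of_mem hx, ← Real.volume_Icc_pi]
      congr 1 with w
      exact and_iff_right hx
    · rw [indicator_of_notMem hx, show Prod.mk x ⁻¹' T = ∅ from
        eq_empty_of_forall_notMem fun w hw => hx hw.1, measure_empty]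
  calc volume {p : Fin (n + 1) → ℝ | p 0 ∈ s ∧ Fin.tail p ∈ Icc (l (p 0)) (u (p 0))}
      = volume T := (volume_preserving_piFinSuccAbove (fun _ : Fin (n + 1) => ℝ)
          0).measure_preimage hT.nullMeasurableSet
    _ = ∫⁻ x in s, ∏ i, ENNReal.ofReal (u x i - l x i) := by
        rw [Measure.volume_eq_prod, Measure.prod_apply hT, lintegral_congr hslice,
          lintegral_indicator hs]

theorem abs_sub_le_integral_of_abs_deriv_le {u ψ : ℝ → ℝ} {a b : ℝ} (hab : a ≤ b)
    (hu : AbsolutelyContinuousOnInterval u a b) (hψ : IntervalIntegrable ψ volume a b)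
    (h : ∀ᵐ t, t ∈ Ioc a b → |deriv u t| ≤ ψ t) : |u b - u a| ≤ ∫ t in a..b, ψ t := by
  rw [← hu.integral_deriv_eq_sub, ← Real.norm_eq_abs]
  exact intervalIntegral.norm_integral_le_of_norm_le hab h hψ

section SubunitCurves

variable {m n : ℕ} {A : (Fin n → ℝ) → Matrix (Fin n) (Fin n) ℝ}
  {A' : (Fin m → ℝ) → Matrix (Fin m) (Fin m) ℝ} {p q : Fin n → ℝ} {r R : ℝ} {γ : ℝ → Fin n → ℝ}

theorem mem_ccBall_iff : q ∈ ccBall A p R ↔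
    ∃ r : ℝ, 0 < r ∧ r < R ∧ ∃ γ : ℝ → Fin n → ℝ, IsSubunit A r γ ∧ γ 0 = p ∧ γ r = q := by
  simp only [ccBall, ccDist, mem_ofPred_eq, sInf_lt_iff]
  constructor
  · rintro ⟨_, ⟨r, hr, rfl, hγ⟩, hlt⟩
    exact ⟨r, hr, (ENNReal.ofReal_lt_ofReal_iff_of_nonneg hr.le).1 hlt, hγ⟩
  · rintro ⟨r, hr, hrR, hγ⟩
    exact ⟨_, ⟨r, hr, rfl, hγ⟩, (ENNReal.ofReal_lt_ofReal_iff_of_nonneg hr.le).2 hrR⟩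

theorem IsSubunit.mulVec {M : Matrix (Fin m) (Fin n) ℝ} (hγ : IsSubunit A r γ)
    (hM : ∀ p ξ, (ξ ᵥ* M) ⬝ᵥ (A p *ᵥ (ξ ᵥ* M)) ≤ ξ ⬝ᵥ (A' (M *ᵥ p) *ᵥ ξ)) :
    IsSubunit A' r fun t => M *ᵥ γ t := by
  obtain ⟨⟨K, hK⟩, hsub⟩ := hγ
  set L : (Fin n → ℝ) →L[ℝ] (Fin m → ℝ) := M.mulVecLin.toContinuousLinearMap
  refine ⟨⟨_, L.lipschitz.comp_lipschitzOnWith hK⟩, ?_⟩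
  filter_upwards [hsub] with t ⟨hdiff, hle⟩
  have hderiv : HasDerivAt (fun t => M *ᵥ γ t) (M *ᵥ deriv γ t) t :=
    L.hasFDerivAt.comp_hasDerivAt t hdiff.hasDerivAt
  refine ⟨hderiv.differentiableAt, fun ξ => ?_⟩
  rw [hderiv.deriv, Matrix.dotProduct_mulVec]
  exact (hle _).trans (hM _ _)

theorem image_mulVec_ccBall_subset {M : Matrix (Fin m) (Fin n) ℝ}
    (hM : ∀ p ξ, (ξ ᵥ* M) ⬝ᵥ (A p *ᵥ (ξ ᵥ* M)) ≤ ξ ⬝ᵥ (A' (M *ᵥ p) *ᵥ ξ)) :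
    (M *ᵥ ·) '' ccBall A p R ⊆ ccBall A' (M *ᵥ p) R := by
  rintro _ ⟨q, hq, rfl⟩
  obtain ⟨r, hr, hrR, γ, hγ, rfl, rfl⟩ := mem_ccBall_iff.1 hq
  exact mem_ccBall_iff.2 ⟨r, hr, hrR, _, hγ.mulVec hM, rfl, rfl⟩

theorem IsSubunit.ae_abs_deriv_apply_le (hγ : IsSubunit A r γ) (i : Fin n) :
    ∀ᵐ t ∂volume.restrict (Icc 0 r), |deriv (γ · i) t| ≤ √(A (γ t) i i) := by
  filter_upwards [hγ.2] with t ⟨hdiff, hle⟩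
  rw [(hasDerivAt_pi.1 hdiff.hasDerivAt i).deriv]
  exact Real.abs_le_sqrt (by simpa using hle (Pi.single i 1))

theorem IsSubunit.abs_apply_sub_le_integral {ψ : ℝ → ℝ} {s t : ℝ} (hγ : IsSubunit A r γ)
    (i : Fin n) (hs : 0 ≤ s) (hst : s ≤ t) (htr : t ≤ r) (hψ : IntervalIntegrable ψ volume s t)
    (hle : ∀ u ∈ Icc s t, √(A (γ u) i i) ≤ ψ u) : |γ t i - γ s i| ≤ ∫ u in s..t, ψ u := by
  obtain ⟨K, hK⟩ := hγ.1
  have hsub : Icc s t ⊆ Icc 0 r := Icc_subset_Icc hs htr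
  have hlip : LipschitzOnWith _ (γ · i) (uIcc s t) :=
    (LipschitzWith.eval i).comp_lipschitzOnWith (hK.mono (uIcc_of_le hst ▸ hsub))
  refine abs_sub_le_integral_of_abs_deriv_le hst hlip.absolutelyContinuousOnInterval hψ ?_
  have hderiv := (ae_restrict_iff' measurableSet_Icc).1 (hγ.ae_abs_deriv_apply_le i)
  filter_upwards [hderiv] with u hu hust
  have hu' := Ioc_subset_Icc_self hust
  exact (hu (hsub hu')).trans (hle u hu')

theorem IsSubunit.abs_apply_sub_le {s t : ℝ} {j : Fin n} (hγ : IsSubunit A r γ)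
    (hj : ∀ x, A x j j ≤ 1) (hs : 0 ≤ s) (hst : s ≤ t) (htr : t ≤ r) :
    |γ t j - γ s j| ≤ t - s := by
  simpa using hγ.abs_apply_sub_le_integral j hs hst htr (intervalIntegrable_const (c := (1 : ℝ)))
    fun u _ => Real.sqrt_le_one.2 (hj _)

theorem IsSubunit.abs_apply_sub_le_tent {t : ℝ} {j : Fin n} (hγ : IsSubunit A r γ)
    (hj : ∀ x, A x j j ≤ 1) (ht : t ∈ Icc 0 r) :
    |γ t j - γ 0 j| ≤ (|γ r j - γ 0 j| + r) / 2 - |t - (|γ r j - γ 0 j| + r) / 2| := by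
  have hstart := hγ.abs_apply_sub_le hj le_rfl ht.1 ht.2
  have hend := hγ.abs_apply_sub_le hj ht.1 ht.2 le_rfl
  have htri := abs_sub_le (γ t j) (γ r j) (γ 0 j)
  rw [abs_sub_comm (γ t j) (γ r j)] at htri
  rcases abs_cases (t - (|γ r j - γ 0 j| + r) / 2) with ⟨h, -⟩ | ⟨h, -⟩ <;> rw [h] <;> linarith

theorem abs_apply_sub_lt_of_mem_ccBall {j : Fin n} (hj : ∀ x, A x j j ≤ 1) (hq : q ∈ ccBall A p R) :
    |q j - p j| < R := by
  obtain ⟨r, hr, hrR, γ, hγ, rfl, rfl⟩ := mem_ccBall_iff.1 hq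
  linarith [hγ.abs_apply_sub_le hj le_rfl hr.le le_rfl]

/-- The half-width at `x` of the cusp that contains the ball of radius `R` about `0` when motion in
the transversal direction has speed at most `c * exp (-a * (R - |x|))` over `x`. -/
noncomputable def cuspWidth (a c R x : ℝ) : ℝ :=
  2 * c / a * Real.exp (-(a / 2 * (R - |x|)))

theorem abs_apply_sub_le_of_mem_ccBall {i j : Fin n} {a c : ℝ} (ha : 0 < a) (hc : 0 ≤ c)
    (hj : ∀ x, A x j j ≤ 1)
    (hi : ∀ x, |x j - p j| < R → √(A x i i) ≤ c * Real.exp (-(a * (R - |x j - p j|))))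
    (hq : q ∈ ccBall A p R) :
    |q i - p i| ≤ cuspWidth a c R (q j - p j) := by
  obtain ⟨r, hr, hrR, γ, hγ, rfl, rfl⟩ := mem_ccBall_iff.1 hq
  set τ := (|γ r j - γ 0 j| + r) / 2 with hτ
  have hspeed (t : ℝ) (ht : t ∈ Icc 0 r) : √(A (γ t) i i) ≤
      c * Real.exp (-(a * (R - τ))) * Real.exp (-(a * |t - τ|)) := by
    have hlt : |γ t j - γ 0 j| < R := by
      linarith [hγ.abs_apply_sub_le hj le_rfl ht.1 ht.2, ht.2]
    rw [mul_assoc, ← Real.exp_add, ← neg_add, ← mul_add]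
    refine (hi _ hlt).trans ?_
    gcongr
    linarith [hγ.abs_apply_sub_le_tent hj ht]
  calc |γ r i - γ 0 i|
      ≤ ∫ t in 0..r, c * Real.exp (-(a * (R - τ))) * Real.exp (-(a * |t - τ|)) :=
        hγ.abs_apply_sub_le_integral i le_rfl hr.le le_rfl
          (Continuous.intervalIntegrable (by fun_prop) _ _) hspeed
    _ = c * Real.exp (-(a * (R - τ))) * ∫ t in 0..r, Real.exp (-(a * |t - τ|)) :=
        intervalIntegral.integral_const_mul _ _
    _ ≤ c * Real.exp (-(a / 2 * (R - |γ r j - γ 0 j|))) * (2 / a) := by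
        have hint := intervalIntegral_exp_neg_mul_abs_sub_le ha τ hr.le
        have hexp : a / 2 * (R - |γ r j - γ 0 j|) ≤ a * (R - τ) := by
          rw [hτ]; linarith [mul_lt_mul_of_pos_left hrR ha]
        exact mul_le_mul (by gcongr) hint (intervalIntegral.integral_nonneg hr.le fun t _ =>
          (Real.exp_pos _).le) (by positivity)
    _ = cuspWidth a c R (γ r j - γ 0 j) := by rw [cuspWidth]; ring

end SubunitCurves

section Volume

variable {n : ℕ} {A : (Fin (n + 1) → ℝ) → Matrix (Fin (n + 1)) (Fin (n + 1)) ℝ}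
  {p : Fin (n + 1) → ℝ} {R : ℝ} {a c : Fin n → ℝ}

theorem ccBall_subset_setOf_tail_mem_Icc (ha : ∀ i, 0 < a i) (hc : ∀ i, 0 ≤ c i)
    (h0 : ∀ x, A x 0 0 ≤ 1) (hsucc : ∀ i x, |x 0 - p 0| < R →
      √(A x i.succ i.succ) ≤ c i * Real.exp (-(a i * (R - |x 0 - p 0|)))) :
    ccBall A p R ⊆ {q | q 0 ∈ Icc (p 0 - R) (p 0 + R) ∧ Fin.tail q ∈
      Icc (fun i => p i.succ - cuspWidth (a i) (c i) R (q 0 - p 0))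
        (fun i => p i.succ + cuspWidth (a i) (c i) R (q 0 - p 0))} := by
  intro q hq
  have htail (i : Fin n) : |q i.succ - p i.succ| ≤ cuspWidth (a i) (c i) R (q 0 - p 0) :=
    abs_apply_sub_le_of_mem_ccBall (ha i) (hc i) h0 (hsucc i) hq
  rw [mem_ofPred_eq, ← Real.closedBall_eq_Icc]
  exact ⟨(abs_apply_sub_lt_of_mem_ccBall h0 hq).le,
    fun i => sub_le_of_abs_sub_le_left (htail i),
    fun i => sub_le_iff_le_add'.1 (le_of_abs_le (htail i))⟩

theorem prod_two_mul_cuspWidth (a c : Fin n → ℝ) (R x : ℝ) :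
    ∏ i, 2 * cuspWidth (a i) (c i) R x =
      (∏ i, 4 * c i / a i) * Real.exp (-((∑ i, a i) / 2 * (R - |x|))) := by
  rw [Finset.sum_div, Finset.sum_mul, ← Finset.sum_neg_distrib, Real.exp_sum,
    ← Finset.prod_mul_distrib]
  exact Finset.prod_congr rfl fun i _ => by rw [cuspWidth]; ring

theorem volume_ccBall_le [NeZero n] (ha : ∀ i, 0 < a i) (hc : ∀ i, 0 ≤ c i)
    (h0 : ∀ x, A x 0 0 ≤ 1) (hsucc : ∀ i x, |x 0 - p 0| < R →
      √(A x i.succ i.succ) ≤ c i * Real.exp (-(a i * (R - |x 0 - p 0|)))) :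
    volume (ccBall A p R) ≤ ENNReal.ofReal ((∏ i, 4 * c i / a i) * (8 / ∑ i, a i)) := by
  have hsum : 0 < ∑ i, a i := Finset.sum_pos (fun i _ => ha i) Finset.univ_nonempty
  have hcoef : 0 ≤ ∏ i, 4 * c i / a i :=
    Finset.prod_nonneg fun i _ => div_nonneg (mul_nonneg zero_le_four (hc i)) (ha i).le
  have hwidth (i : Fin n) (x : ℝ) : 0 ≤ 2 * cuspWidth (a i) (c i) R x :=
    mul_nonneg zero_le_two (mul_nonneg (div_nonneg (mul_nonneg zero_le_two (hc i)) (ha i).le)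
      (Real.exp_pos _).le)
  have hmeas (i : Fin n) : Measurable fun x => cuspWidth (a i) (c i) R (x - p 0) := by
    unfold cuspWidth
    fun_prop
  calc volume (ccBall A p R)
      ≤ ∫⁻ x in Icc (p 0 - R) (p 0 + R), ∏ i, ENNReal.ofReal
          (p i.succ + cuspWidth (a i) (c i) R (x - p 0) -
            (p i.succ - cuspWidth (a i) (c i) R (x - p 0))) :=
        (measure_mono (ccBall_subset_setOf_tail_mem_Icc ha hc h0 hsucc)).trans_eq <|
          volume_setOf_tail_mem_Icc measurableSet_Icc
            (l := fun x i => p i.succ - cuspWidth (a i) (c i) R (x - p 0))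
            (u := fun x i => p i.succ + cuspWidth (a i) (c i) R (x - p 0))
            (by fun_prop) (by fun_prop)
    _ = ∫⁻ x in Icc (p 0 - R) (p 0 + R), ENNReal.ofReal (∏ i, 4 * c i / a i) *
          ENNReal.ofReal (Real.exp (-((∑ i, a i) / 2 * (R - |x - p 0|)))) := by
        refine lintegral_congr fun x => ?_
        simp only [add_sub_sub_cancel, ← two_mul]
        rw [← ENNReal.ofReal_prod_of_nonneg fun i _ => hwidth i _, prod_two_mul_cuspWidth,
          ENNReal.ofReal_mul hcoef]
    _ ≤ ENNReal.ofReal (∏ i, 4 * c i / a i) * ENNReal.ofReal (4 / ((∑ i, a i) / 2)) := by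
        rw [lintegral_const_mul _ (by fun_prop)]
        gcongr
        exact lintegral_exp_neg_mul_sub_abs_sub_le (half_pos hsum) _ _
    _ = ENNReal.ofReal ((∏ i, 4 * c i / a i) * (8 / ∑ i, a i)) := by
        rw [← ENNReal.ofReal_mul hcoef, div_div_eq_mul_div]
        norm_num

end Volume

theorem image_ccBall_diag3_subset_diag2_left (f g : ℝ → ℝ) (R : ℝ) :
    (fun p : Fin 3 → ℝ => ![p 0, p 1]) '' ccBall (diag3 f g) 0 R ⊆ ccBall (diag2 f) 0 R := by
  have hproj (p : Fin 3 → ℝ) : !![1, 0, 0; 0, 1, 0] *ᵥ p = ![p 0, p 1] := by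
    simp [dotProduct, Fin.sum_univ_three]
  have h := image_mulVec_ccBall_subset (A := diag3 f g) (A' := diag2 f) (p := 0) (R := R)
    (M := !![1, 0, 0; 0, 1, 0]) fun p ξ => by
      simp [hproj, diag2, diag3, dotProduct, Matrix.mulVec_diagonal, Fin.sum_univ_succ,
        Matrix.vecHead, Matrix.vecTail]
  rw [Matrix.mulVec_zero] at h
  simpa only [hproj] using h

theorem image_ccBall_diag3_subset_diag2_right (f g : ℝ → ℝ) (R : ℝ) :
    (fun p : Fin 3 → ℝ => ![p 0, p 2]) '' ccBall (diag3 f g) 0 R ⊆ ccBall (diag2 g) 0 R := by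
  have hproj (p : Fin 3 → ℝ) : !![1, 0, 0; 0, 0, 1] *ᵥ p = ![p 0, p 2] := by
    simp [dotProduct, Fin.sum_univ_three]
  have h := image_mulVec_ccBall_subset (A := diag3 f g) (A' := diag2 g) (p := 0) (R := R)
    (M := !![1, 0, 0; 0, 0, 1]) fun p ξ => by
      simp [hproj, diag2, diag3, dotProduct, Matrix.mulVec_diagonal, Fin.sum_univ_succ,
        Matrix.vecHead, Matrix.vecTail]
  rw [Matrix.mulVec_zero] at h
  simpa only [hproj] using h

/-- A profile `f` that is even on `(-R, R)`, and positive and log-concave on `(0, R]`. At `0` only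
right continuity is asked for, so `f` need not vanish there. `deriv_neg` also encodes that `-ln f`
is differentiable at `R`, since `deriv` is `0` otherwise. -/
structure IsLogConcaveProfile (f : ℝ → ℝ) (R : ℝ) : Prop where
  even : ∀ x ∈ Ioo 0 R, f (-x) = f x
  pos : ∀ x ∈ Ioc 0 R, 0 < f x
  continuousWithinAt : ContinuousWithinAt f (Ioi 0) 0
  convexOn : ConvexOn ℝ (Ioc 0 R) (negLog f)
  deriv_neg : deriv (negLog f) R < 0

section Profiles

variable {f g : ℝ → ℝ} {R₀ R : ℝ}

theorem IsDegenerateProfile.isLogConcaveProfile (hf : IsDegenerateProfile f R₀)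
    (hR : R ∈ Ioo 0 R₀) : IsLogConcaveProfile f R where
  even x hx := hf.even x ⟨hx.1, hx.2.trans hR.2⟩
  pos x hx := hf.pos x ⟨hx.1, hx.2.trans_lt hR.2⟩
  continuousWithinAt := by
    have hexp : Tendsto (fun x => Real.exp (-negLog f x)) (𝓝[>] 0) (𝓝 0) :=
      Real.tendsto_exp_neg_atTop_nhds_zero.comp hf.tendsto
    rw [ContinuousWithinAt, hf.map_zero]
    refine hexp.congr' ?_
    filter_upwards [Ioo_mem_nhdsGT (hR.1.trans hR.2)] with x hx
    rw [negLog, neg_neg, Real.exp_log (hf.pos x hx)]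
  convexOn := by
    refine (convexOn_of_deriv2_nonneg' (convex_Ioo 0 R₀)
      (fun x hx => (hf.differentiableAt x hx).differentiableWithinAt)
      (fun x hx => (hf.differentiableAt_deriv x hx).differentiableWithinAt)
      fun x hx => (hf.deriv_deriv_pos x hx).le).subset ?_ (convex_Ioc 0 R)
    exact fun x hx => ⟨hx.1, hx.2.trans_lt hR.2⟩
  deriv_neg := hf.deriv_neg R hR

theorem IsLogConcaveProfile.apply_le_exp_of_pos (hf : IsLogConcaveProfile f R) {x : ℝ}
    (hx : x ∈ Ioo 0 R) :
    f x ≤ f R * Real.exp (-(|deriv (negLog f) R| * (R - x))) := by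
  have hR : R ∈ Ioc 0 R := right_mem_Ioc.2 (hx.1.trans hx.2)
  have hx' : x ∈ Ioc 0 R := Ioo_subset_Ioc_self hx
  have hslope := hf.convexOn.slope_le_deriv hx' hR hx.2
    (differentiableAt_of_deriv_ne_zero hf.deriv_neg.ne)
  rw [slope_def_field, div_le_iff₀ (sub_pos.2 hx.2), negLog, negLog] at hslope
  rw [abs_of_neg hf.deriv_neg, ← Real.exp_log (hf.pos x hx'), ← Real.exp_log (hf.pos R hR),
    ← Real.exp_add, Real.exp_le_exp]
  linarith

theorem IsLogConcaveProfile.abs_apply_le_exp (hf : IsLogConcaveProfile f R) {x : ℝ} (hx : |x| < R) :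
    |f x| ≤ f R * Real.exp (-(|deriv (negLog f) R| * (R - |x|))) := by
  have hpos (y : ℝ) (hy : y ∈ Ioo 0 R) :
      |f y| ≤ f R * Real.exp (-(|deriv (negLog f) R| * (R - y))) := by
    rw [abs_of_pos (hf.pos y (Ioo_subset_Ioc_self hy))]
    exact hf.apply_le_exp_of_pos hy
  rcases lt_trichotomy x 0 with hneg | rfl | hx0
  · rw [abs_of_neg hneg] at hx ⊢
    have hmem : -x ∈ Ioo 0 R := ⟨neg_pos.2 hneg, hx⟩
    rw [← neg_neg x, hf.even _ hmem, neg_neg]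
    exact hpos _ hmem
  · rw [abs_zero] at hx ⊢
    have hcont : ContinuousWithinAt
        (fun y => f R * Real.exp (-(|deriv (negLog f) R| * (R - y)))) (Ioi 0) 0 :=
      Continuous.continuousWithinAt (by fun_prop)
    refine le_of_tendsto_of_tendsto hf.continuousWithinAt.abs hcont ?_
    filter_upwards [Ioo_mem_nhdsGT hx] using hpos
  · rw [abs_of_pos hx0] at hx ⊢
    exact hpos x ⟨hx0, hx⟩

theorem IsLogConcaveProfile.volume_ccBall_diag3_le (hf : IsLogConcaveProfile f R)
    (hg : IsLogConcaveProfile g R) (hR : 0 < R) :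
    volume (ccBall (diag3 f g) 0 R) ≤ ENNReal.ofReal (128 * (f R * g R /
      (|deriv (negLog f) R| * |deriv (negLog g) R| *
        (|deriv (negLog f) R| + |deriv (negLog g) R|)))) := by
  have hRmem : R ∈ Ioc 0 R := right_mem_Ioc.2 hR
  refine (volume_ccBall_le (a := ![|deriv (negLog f) R|, |deriv (negLog g) R|])
    (c := ![f R, g R]) ?_ ?_ (fun x => by simp [diag3]) ?_).trans_eq ?_
  · simp [Fin.forall_fin_two, hf.deriv_neg.ne, hg.deriv_neg.ne]
  · simp [Fin.forall_fin_two, (hf.pos R hRmem).le, (hg.pos R hRmem).le]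
  · refine Fin.forall_fin_two.2 ⟨fun x hx => ?_, fun x hx => ?_⟩
    · simpa [diag3, Real.sqrt_sq_eq_abs] using hf.abs_apply_le_exp (by simpa using hx)
    · simpa [diag3, Real.sqrt_sq_eq_abs] using hg.abs_apply_le_exp (by simpa using hx)
  · congr 1
    simp only [Fin.prod_univ_two, Fin.sum_univ_two, Matrix.cons_val_zero, Matrix.cons_val_one]
    field_simp
    ring

end Profiles

end CarnotCaratheodory

open CarnotCaratheodory in
theorem mainTheorem1_general {f g : ℝ → ℝ} {R : ℝ} (hf : IsLogConcaveProfile f R)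
    (hg : IsLogConcaveProfile g R) (hR : 0 < R) :
    (fun p : Fin 3 → ℝ => ![p 0, p 1]) '' ccBall (diag3 f g) 0 R ⊆ ccBall (diag2 f) 0 R ∧
      (fun p : Fin 3 → ℝ => ![p 0, p 2]) '' ccBall (diag3 f g) 0 R ⊆ ccBall (diag2 g) 0 R ∧
      volume (ccBall (diag3 f g) 0 R) ≤ ENNReal.ofReal (128 * min
        (f R * g R / (|deriv (negLog f) R| ^ 2 * |deriv (negLog g) R|))
        (f R * g R / (|deriv (negLog f) R| * |deriv (negLog g) R| ^ 2))) := by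
  refine ⟨image_ccBall_diag3_subset_diag2_left f g R, image_ccBall_diag3_subset_diag2_right f g R,
    (hf.volume_ccBall_diag3_le hg hR).trans (ENNReal.ofReal_le_ofReal ?_)⟩
  have hfR := hf.pos R (right_mem_Ioc.2 hR)
  have hgR := hg.pos R (right_mem_Ioc.2 hR)
  have ha : 0 < |deriv (negLog f) R| := abs_pos.2 hf.deriv_neg.ne
  have hb : 0 < |deriv (negLog g) R| := abs_pos.2 hg.deriv_neg.ne
  gcongr
  refine le_min (div_le_div_of_nonneg_left (by positivity) (by positivity) ?_)
    (div_le_div_of_nonneg_left (by positivity) (by positivity) ?_)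
  · nlinarith [mul_pos (mul_pos ha hb) hb]
  · nlinarith [mul_pos (mul_pos ha hb) ha]

theorem mainTheorem1 :
    ∃ C : ℝ, 0 < C ∧ ∀ (f g : ℝ → ℝ) (R₀ : ℝ),
      CarnotCaratheodory.IsDegenerateProfile f R₀ →
      CarnotCaratheodory.IsDegenerateProfile g R₀ →
      ∀ R : ℝ, 0 < R → R < R₀ →
        (fun p : Fin 3 → ℝ => ![p 0, p 1]) ''
            CarnotCaratheodory.ccBall (CarnotCaratheodory.diag3 f g) 0 R ⊆
          CarnotCaratheodory.ccBall (CarnotCaratheodory.diag2 f) 0 R ∧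
        (fun p : Fin 3 → ℝ => ![p 0, p 2]) ''
            CarnotCaratheodory.ccBall (CarnotCaratheodory.diag3 f g) 0 R ⊆
          CarnotCaratheodory.ccBall (CarnotCaratheodory.diag2 g) 0 R ∧
        volume (CarnotCaratheodory.ccBall (CarnotCaratheodory.diag3 f g) 0 R) ≤
          ENNReal.ofReal (C * min
            (f R * g R / (|deriv (CarnotCaratheodory.negLog f) R| ^ 2 *
              |deriv (CarnotCaratheodory.negLog g) R|))
            (f R * g R / (|deriv (CarnotCaratheodory.negLog f) R| *
              |deriv (CarnotCaratheodory.negLog g) R| ^ 2))) :=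
  ⟨128, by norm_num, fun _ _ _ hf hg _ hR hRR₀ => mainTheorem1_general
    (hf.isLogConcaveProfile ⟨hR, hRR₀⟩) (hg.isLogConcaveProfile ⟨hR, hRR₀⟩) hR⟩
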